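/- Let $S\subset\mathbb{R}^d$ be compact and such that every nonempty relatively open subset of $S$ has positive Lebesgue measure. Let $k:S\times S\to\mathbb{R}$ be a continuous symmetric positive (semi)definite kernel with reproducing kernel Hilbert space (RKHS) $\mathcal{H}_k$, and let $\gamma>0$. Let $(\eta_i,\phi_i)_i$ be the Mercer eigenpairs of $k$: the $\phi_i$ are orthonormal in $L^2(S)$, $\int_S k(t,s)\phi_i(s)\,ds=\eta_i\phi_i(t)$ for all $t\in S$, and every nonzero eigenvalue of the integral operator of $k$ on $L^2(S)$ is listed with its full multiplicity. Then the series $$\tilde k(t,t')=\sum_i\frac{\eta_i}{\eta_i+\gamma}\,\phi_i(t)\phi_i(t')$$ converges absolutely for all $t,t'\in S$ and defines a symmetric positive semidefinite kernel $\tilde k$ on $S$; its RKHS $\mathcal{H}_{\tilde k}$ consists of the same functions as $\mathcal{H}_k$; and every $h\in\mathcal{H}_k$ is square integrable on $S$ and satisfies $$\int_S h^2(t)\,dt+\gamma\|h\|_{\mathcal{H}_k}^2=\|h\|_{\mathcal{H}_{\tilde k}}^2 .$$ Consequently, for all $n\ge 0$, all $t_1,\dots,t_n\in S$ and all $h\in\mathcal{H}_k$,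 the penalized objective $$J(h)=-\sum_{i=1}^n\log h^2(t_i)+\int_S h^2(t)\,dt+\gamma\|h\|_{\mathcal{H}_k}^2$$ (with values in $(-\infty,+\infty]$, where $-\log 0=+\infty$) equals $$J(h)=-\sum_{i=1}^n\log h^2(t_i)+\|h\|_{\mathcal{H}_{\tilde k}}^2 .$$ -/

import Mathlib

open MeasureTheory

noncomputable section

/-- Lebesgue measure on a subset `S` of `ℝᵈ`, as a measure on the type `S`. -/
def lebesgueOn {d : ℕ} (S : Set (EuclideanSpace ℝ (Fin d))) : Measure S :=
  Measure.comap Subtype.val volume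

/-- A real-valued kernel `k` on `X`, written as a kernel with values in the operators on `ℝ`
(the scalar `k x y` acts by multiplication), which is the form that Mathlib's reproducing kernel
Hilbert spaces use. -/
def scalarKernel {X : Type*} (k : X → X → ℝ) : Matrix X X (ℝ →L[ℝ] ℝ) :=
  Matrix.of fun x y => k x y • ContinuousLinearMap.id ℝ ℝ

/-- `k` is a symmetric positive (semi)definite kernel: `k x y = k y x`, and
`∑ i j, c i * c j * k (x i) (x j) ≥ 0` for all finite families of points and coefficients. -/
def IsPosSemidefKernel {X : Type*} (k : X → X → ℝ) : Prop :=
  (∀ x y, k x y = k y x) ∧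
    ∀ (m : ℕ) (x : Fin m → X) (c : Fin m → ℝ), 0 ≤ ∑ i, ∑ j, c i * c j * k (x i) (x j)

/-- The Hilbert space `H` of real functions on `X` is the reproducing kernel Hilbert space of `k`:
its reproducing kernel is `k`. -/
def IsRKHSOf {X : Type*} (k : X → X → ℝ) (H : Type*) [NormedAddCommGroup H]
    [InnerProductSpace ℝ H] [CompleteSpace H] [RKHS ℝ H X ℝ] : Prop :=
  RKHS.kernel H = scalarKernel k

/-- `(η i, φ i)` is a full system of eigenvalues and orthonormal eigenfunctions of the integral
operator `f ↦ ∫ k(·, y) f(y) dμ(y)` on `L²(μ)`. Every nonzero eigenvalue is listed as often as its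
multiplicity: no eigenfunction for a nonzero eigenvalue is orthogonal to all `φ i`. Eigenfunctions
for the eigenvalue `0` may be listed, but need not be. -/
structure IsMercerSystem {X : Type*} [MeasurableSpace X] (μ : Measure X) (k : X → X → ℝ)
    {ι : Type*} (η : ι → ℝ) (φ : ι → X → ℝ) : Prop where
  memLp : ∀ i, MemLp (φ i) 2 μ
  norm_one : ∀ i, ∫ x, φ i x ^ 2 ∂μ = 1
  orthogonal : ∀ i j, i ≠ j → ∫ x, φ i x * φ j x ∂μ = 0
  eigen : ∀ i x, ∫ y, k x y * φ i y ∂μ = η i * φ i x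
  exhaustive : ∀ (c : ℝ) (f : X → ℝ), c ≠ 0 → MemLp f 2 μ →
    (∀ x, ∫ y, k x y * f y ∂μ = c * f x) → (∀ i, ∫ x, f x * φ i x ∂μ = 0) → f =ᵐ[μ] 0

/-- The new kernel `k̃(x, y) = ∑ i, η i / (η i + γ) * φ i x * φ i y`. -/
def transformedKernel {X ι : Type*} (γ : ℝ) (η : ι → ℝ) (φ : ι → X → ℝ) (x y : X) : ℝ :=
  ∑' i, η i / (η i + γ) * φ i x * φ i y

/-- The data term `-∑ i, log (h (t i) ^ 2)`, with `-log 0 = +∞`. -/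
def dataTerm {X : Type*} {n : ℕ} (t : Fin n → X) (h : X → ℝ) : EReal :=
  -∑ i, ENNReal.log (ENNReal.ofReal (h (t i) ^ 2))

/-- The penalized objective
`J(h) = -∑ i, log (h (t i) ^ 2) + ∫ h² dμ + γ ‖h‖²` for `h` in a space `H` of functions. -/
def penalizedObjective {X : Type*} [MeasurableSpace X] (μ : Measure X) {n : ℕ} (t : Fin n → X)
    (γ : ℝ) {H : Type*} [NormedAddCommGroup H] [InnerProductSpace ℝ H] [RKHS ℝ H X ℝ]
    (h : H) : EReal :=
  dataTerm t h + ((∫ x, h x ^ 2 ∂μ : ℝ) : EReal) + ((γ * ‖h‖ ^ 2 : ℝ) : EReal)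

/-- The objective `-∑ i, log (h (t i) ^ 2) + ‖h‖²` for `h` in a space `H` of functions. -/
def mergedObjective {X : Type*} {n : ℕ} (t : Fin n → X)
    {H : Type*} [NormedAddCommGroup H] [InnerProductSpace ℝ H] [RKHS ℝ H X ℝ]
    (h : H) : EReal :=
  dataTerm t h + ((‖h‖ ^ 2 : ℝ) : EReal)

end

/-! Let `J` be the inclusion of `H` into L² and `B = J†J + γ`. Then `⟪B f, g⟫ = ∫ f g + γ ⟪f, g⟫` is
an equivalent inner product on `H`, whose evaluation representers are `B⁻¹ k_x`. So `H` with this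
product is the RKHS of `⟪k_x, B⁻¹ k_y⟫`, and the claim reduces to identifying this kernel with `k̃`.
`J†` acts as the integral operator, and the functions `√η i * φ i` with `η i ≠ 0` form a Hilbert
basis of `H` that diagonalizes `J†J` (`exists_hilbertBasis`). Expanding in this basis gives the
series for `k̃` (`hasSum_transformedKernel`). Uniqueness of the RKHS, in the form of
`exists_equiv_of_kernel_eq_inner_symm`, transfers the norm identity to any `H'` with kernel `k̃`. -/

open scoped InnerProductSpace RealInnerProductSpace

/-! ### Representers of evaluation -/

section KernelVectors

variable {X : Type*} (H : Type*) [NormedAddCommGroup H] [InnerProductSpace ℝ H]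
  [CompleteSpace H] [RKHS ℝ H X ℝ]

/-- The representer of the evaluation at `x` in a real reproducing kernel Hilbert space. -/
noncomputable def kerVec (x : X) : H := RKHS.kerFun H x 1

variable {H}

theorem inner_kerVec_left (x : X) (h : H) : ⟪kerVec H x, h⟫_ℝ = h x := by
  simp [kerVec]

theorem inner_kerVec_right (x : X) (h : H) : ⟪h, kerVec H x⟫_ℝ = h x := by
  rw [real_inner_comm, inner_kerVec_left]

theorem IsRKHSOf.kerVec_apply {k : X → X → ℝ} (hH : IsRKHSOf k H) (x y : X) :
    kerVec H y x = k x y := by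
  have h : RKHS.kernel H = scalarKernel k := hH
  simp [kerVec, RKHS.kerFun_apply, h, scalarKernel]

theorem eq_zero_of_forall_inner_kerVec {h : H} (hh : ∀ x, ⟪kerVec H x, h⟫_ℝ = 0) : h = 0 :=
  RKHS.ext fun x => by rw [← inner_kerVec_left, hh, RKHS.coe_zero, Pi.zero_apply]

theorem orthogonal_span_kerVec :
    (Submodule.span ℝ (Set.range (kerVec H : X → H)))ᗮ = ⊥ := by
  rw [Submodule.eq_bot_iff]
  intro h hh
  exact eq_zero_of_forall_inner_kerVec fun x =>
    (Submodule.mem_orthogonal _ _).1 hh _ (Submodule.subset_span ⟨x, rfl⟩)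

/-- The squared distance between representers is `k y y - 2 * k y x + k x x`, which tends to `0` as
`y → x`. -/
theorem IsRKHSOf.continuous_kerVec [TopologicalSpace X] {k : X → X → ℝ} (hH : IsRKHSOf k H)
    (hk : Continuous fun p : X × X => k p.1 p.2) : Continuous (kerVec H : X → H) := by
  rw [continuous_iff_continuousAt]
  intro x
  rw [ContinuousAt, tendsto_iff_norm_sub_tendsto_zero]
  have hsq : ∀ y, ‖kerVec H y - kerVec H x‖ = √(k y y - 2 * k y x + k x x) := by
    intro y
    rw [← Real.sqrt_sq (norm_nonneg _), norm_sub_sq_real, ← real_inner_self_eq_norm_sq,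
      ← real_inner_self_eq_norm_sq, inner_kerVec_left, inner_kerVec_left, inner_kerVec_right,
      hH.kerVec_apply, hH.kerVec_apply, hH.kerVec_apply]
  simp_rw [hsq]
  have hyy : Continuous fun y => k y y := hk.comp (continuous_id.prodMk continuous_id)
  have hxy : Continuous fun y => k y x := hk.comp (continuous_id.prodMk continuous_const)
  have hc : Continuous fun y => √(k y y - 2 * k y x + k x x) := by fun_prop
  simpa [show k x x - 2 * k x x + k x x = 0 by ring] using hc.tendsto x

theorem RKHS.continuous_coe_of_continuous_kerVec [TopologicalSpace X]
    (hc : Continuous (kerVec H : X → H)) (h : H) : Continuous (h : X → ℝ) := by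
  have : (h : X → ℝ) = fun x => ⟪kerVec H x, h⟫_ℝ := funext fun x => (inner_kerVec_left x h).symm
  rw [this]
  fun_prop

end KernelVectors

/-! ### Compact inclusion into L² -/

section Embedding

variable {X : Type*} [TopologicalSpace X] [CompactSpace X]
  {H : Type*} [NormedAddCommGroup H] [InnerProductSpace ℝ H] [CompleteSpace H] [RKHS ℝ H X ℝ]

/-- Arzelà–Ascoli: on the unit ball `|h x - h y| ≤ ‖k_x - k_y‖`, so continuity of the representers
gives equicontinuity, and their boundedness on compact `X` gives a uniform bound. -/
theorem RKHS.exists_isCompactOperator_boundedContinuousFunction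
    (hc : Continuous (kerVec H : X → H)) :
    ∃ j : H →L[ℝ] BoundedContinuousFunction X ℝ, (∀ h x, j h x = h x) ∧ IsCompactOperator j := by
  obtain ⟨C, hC⟩ := isCompact_univ.exists_bound_of_continuousOn (f := (kerVec H : X → H))
    hc.continuousOn
  have hC0 : 0 ≤ max C 0 := le_max_right _ _
  have hbd : ∀ (h : H) (x : X), ‖h x‖ ≤ max C 0 * ‖h‖ := by
    intro h x
    rw [← inner_kerVec_left]
    refine (norm_inner_le_norm _ _).trans ?_
    gcongr
    exact (hC x trivial).trans (le_max_left _ _)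
  let j₀ : H →ₗ[ℝ] BoundedContinuousFunction X ℝ :=
    { toFun := fun h => BoundedContinuousFunction.mkOfCompact
        ⟨h, RKHS.continuous_coe_of_continuous_kerVec hc h⟩
      map_add' := fun f g => by ext x; simp
      map_smul' := fun c f => by ext x; simp }
  have hj₀ : ∀ h x, j₀ h x = h x := fun h x => rfl
  let j : H →L[ℝ] BoundedContinuousFunction X ℝ := j₀.mkContinuous (max C 0) fun h => by
    rw [BoundedContinuousFunction.norm_le (by positivity)]
    exact hbd h
  have hj : ∀ h x, j h x = h x := fun h x => rfl
  refine ⟨j, hj, ?_⟩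
  change IsCompactOperator (j : H →ₗ[ℝ] BoundedContinuousFunction X ℝ)
  rw [isCompactOperator_iff_isCompact_closure_image_closedBall
    (j : H →ₗ[ℝ] BoundedContinuousFunction X ℝ) zero_lt_one]
  refine BoundedContinuousFunction.arzela_ascoli (Metric.closedBall (0 : ℝ) (max C 0))
    (isCompact_closedBall _ _) _ ?_ ?_
  · rintro f x ⟨h, hh, rfl⟩
    rw [mem_closedBall_zero_iff] at hh ⊢
    exact (hbd h x).trans (mul_le_of_le_one_right hC0 hh)
  · intro x₀
    rw [Metric.equicontinuousAt_iff_right]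
    intro ε hε
    have := Metric.tendsto_nhds.1 (hc.tendsto x₀) ε hε
    filter_upwards [this] with x hx
    rintro ⟨_, h, hh, rfl⟩
    rw [mem_closedBall_zero_iff] at hh
    change dist (h x₀) (h x) < ε
    rw [dist_comm, ← inner_kerVec_left, ← inner_kerVec_left, Real.dist_eq, ← inner_sub_left]
    refine (abs_real_inner_le_norm _ _).trans_lt ?_
    rw [← dist_eq_norm]
    exact (mul_le_of_le_one_right dist_nonneg hh).trans_lt hx

/-- Injectivity is where positivity of the measure on open sets enters: continuous functions that
agree almost everywhere then agree everywhere. -/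
theorem RKHS.exists_isCompactOperator_Lp [MeasurableSpace X] [BorelSpace X] (μ : Measure X)
    [IsFiniteMeasure μ] [μ.IsOpenPosMeasure] (hc : Continuous (kerVec H : X → H)) :
    ∃ J : H →L[ℝ] Lp ℝ 2 μ, (∀ h, J h =ᵐ[μ] h) ∧ IsCompactOperator J ∧ Function.Injective J := by
  obtain ⟨j, hj, hjc⟩ := RKHS.exists_isCompactOperator_boundedContinuousFunction hc
  refine ⟨(BoundedContinuousFunction.toLp 2 μ ℝ).comp j, fun h => ?_, ?_, ?_⟩
  · refine (BoundedContinuousFunction.coeFn_toLp 2 μ ℝ (j h)).trans ?_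
    exact Filter.Eventually.of_forall (hj h)
  · exact hjc.clm_comp (BoundedContinuousFunction.toLp (E := ℝ) 2 μ ℝ)
  · refine (BoundedContinuousFunction.toLp_injective (p := 2) (𝕜 := ℝ) μ).comp fun f g hfg => ?_
    exact RKHS.ext fun x => by rw [← hj, ← hj]; exact DFunLike.congr_fun hfg x

end Embedding

/-! ### The regularized inner product -/

section Regularized

variable {H : Type*} [NormedAddCommGroup H] [InnerProductSpace ℝ H] [CompleteSpace H]
  {L : Type*} [NormedAddCommGroup L] [InnerProductSpace ℝ L] [CompleteSpace L]

/-- `J†J + γ` is coercive with constant `γ`, hence invertible. -/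
theorem exists_equiv_adjoint_comp_self_add_smul (J : H →L[ℝ] L) {γ : ℝ} (hγ : 0 < γ) :
    ∃ B : H ≃L[ℝ] H, ∀ v w, ⟪B v, w⟫_ℝ = ⟪J v, J w⟫_ℝ + γ * ⟪v, w⟫_ℝ := by
  let B₀ : H →L[ℝ] H := J.adjoint.comp J + γ • ContinuousLinearMap.id ℝ H
  have hB₀ : ∀ v w, ⟪B₀ v, w⟫_ℝ = ⟪J v, J w⟫_ℝ + γ * ⟪v, w⟫_ℝ := fun v w => by
    simp [B₀, inner_add_left, ContinuousLinearMap.adjoint_inner_left, real_inner_smul_left]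
  have hu : IsUnit B₀ := by
    refine ContinuousLinearMap.isUnit_of_forall_le_norm_inner_map B₀ (c := NNReal.mk γ hγ.le) hγ
      fun x => ?_
    rw [hB₀, real_inner_self_eq_norm_sq, real_inner_self_eq_norm_sq, NNReal.coe_mk]
    refine le_trans ?_ (le_abs_self _)
    nlinarith [sq_nonneg ‖J x‖]
  obtain ⟨u, hu⟩ := hu
  refine ⟨ContinuousLinearEquiv.ofUnit u, fun v w => ?_⟩
  rw [← hB₀, ← hu]
  rfl

end Regularized

/-! ### Uniqueness of the RKHS under a change of inner product -/

section Comparison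

variable {X : Type*} {H : Type*} [NormedAddCommGroup H] [InnerProductSpace ℝ H]
  [CompleteSpace H] [RKHS ℝ H X ℝ] {H' : Type*} [NormedAddCommGroup H']
  [InnerProductSpace ℝ H'] [CompleteSpace H'] [RKHS ℝ H' X ℝ]

theorem denseRange_linearCombination_symm_kerVec (B : H ≃L[ℝ] H) :
    DenseRange (Finsupp.linearCombination ℝ fun x : X => B.symm (kerVec H x)) := by
  have h₁ : DenseRange (Finsupp.linearCombination ℝ (kerVec H : X → H)) := by
    rw [DenseRange, ← LinearMap.coe_range, Finsupp.range_linearCombination,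
      Submodule.dense_iff_topologicalClosure_eq_top,
      Submodule.topologicalClosure_eq_top_iff]
    exact orthogonal_span_kerVec
  have h₂ := B.symm.surjective.denseRange.comp h₁ B.symm.continuous
  convert h₂ using 1
  funext c
  simp [Finsupp.linearCombination_apply, Finsupp.sum, map_sum]

/-- If the kernel of `H'` is the Gram matrix of the functionals `h ↦ h x` with respect to the
equivalent inner product `⟪B f, g⟫` on `H`, then `H'` is `H` with that inner product. -/
theorem RKHS.exists_equiv_of_kernel_eq_inner_symm (B : H ≃L[ℝ] H) {c : ℝ} (hc : 0 < c)
    (hpos : ∀ v, c * ‖v‖ ^ 2 ≤ ⟪B v, v⟫_ℝ)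
    (hker : ∀ x y : X, ⟪kerVec H' x, kerVec H' y⟫_ℝ = ⟪kerVec H x, B.symm (kerVec H y)⟫_ℝ) :
    ∃ U : H → H', Function.Surjective U ∧ (∀ h x, U h x = h x) ∧
      ∀ h, ‖U h‖ ^ 2 = ⟪B h, h⟫_ℝ := by
  set e := Finsupp.linearCombination ℝ fun x : X => B.symm (kerVec H x) with he
  set f := Finsupp.linearCombination ℝ (kerVec H' : X → H') with hf
  have hd : DenseRange e := denseRange_linearCombination_symm_kerVec B
  have hef : ∀ a b, ⟪f a, f b⟫_ℝ = ⟪B (e a), e b⟫_ℝ := by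
    intro a b
    simp only [he, hf, Finsupp.linearCombination_apply, Finsupp.sum, map_sum, map_smul,
      sum_inner, inner_sum, real_inner_smul_left, real_inner_smul_right, hker,
      ContinuousLinearEquiv.apply_symm_apply]
  have hbd : ∀ a, ‖f a‖ ≤ √‖(B : H →L[ℝ] H)‖ * ‖e a‖ := by
    intro a
    rw [← Real.sqrt_sq (norm_nonneg (f a)), ← Real.sqrt_sq (norm_nonneg (e a)),
      ← Real.sqrt_mul (norm_nonneg _)]
    apply Real.sqrt_le_sqrt
    rw [← real_inner_self_eq_norm_sq, hef, sq, ← mul_assoc]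
    exact (real_inner_le_norm _ _).trans
      (mul_le_mul_of_nonneg_right ((B : H →L[ℝ] H).le_opNorm _) (norm_nonneg _))
  -- `U` sends `B⁻¹ k_x` to the representer of `x` in `H'`. By `hef` this preserves the `B`-inner
  -- product on the span, which is dense, so it extends to `H`.
  set U : H →L[ℝ] H' := f.extendOfNorm e with hU
  have hUe : ∀ a, U (e a) = f a := LinearMap.extendOfNorm_eq hd ⟨_, hbd⟩
  have hUx : ∀ x, U (B.symm (kerVec H x)) = kerVec H' x := fun x => by
    simpa [he, hf] using hUe (Finsupp.single x 1)
  have hUinner : ∀ v w, ⟪U v, U w⟫_ℝ = ⟪B v, w⟫_ℝ := by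
    intro v w
    refine hd.induction_on₂ (p := fun v w => ⟪U v, U w⟫_ℝ = ⟪B v, w⟫_ℝ) ?_ ?_ v w
    · exact isClosed_eq (by fun_prop) (by fun_prop)
    · intro a b
      rw [hUe, hUe, hef]
  have hUnorm : ∀ h, ‖U h‖ ^ 2 = ⟪B h, h⟫_ℝ := fun h => by
    rw [← real_inner_self_eq_norm_sq, hUinner]
  refine ⟨U, ?_, fun h x => ?_, hUnorm⟩
  · have hanti : AntilipschitzWith (NNReal.mk (√c) (Real.sqrt_nonneg c))⁻¹ U := by
      refine U.antilipschitz_of_bound fun h => ?_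
      have hsc : 0 < √c := Real.sqrt_pos.2 hc
      rw [NNReal.coe_inv, NNReal.coe_mk, ← div_eq_inv_mul, le_div_iff₀ hsc]
      refine le_of_sq_le_sq ?_ (norm_nonneg _)
      rw [hUnorm, mul_pow, Real.sq_sqrt hc.le, mul_comm]
      exact hpos h
    have hcl : IsClosed (Set.range U) := hanti.isClosed_range U.uniformContinuous
    have hr : U.range = ⊤ := by
      have : CompleteSpace U.range := hcl.completeSpace_coe
      rw [← Submodule.orthogonal_eq_bot_iff, Submodule.eq_bot_iff]
      intro h' hh'
      exact eq_zero_of_forall_inner_kerVec fun x =>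
        (Submodule.mem_orthogonal _ _).1 hh' _ ⟨_, hUx x⟩
    exact LinearMap.range_eq_top.1 hr
  · rw [← inner_kerVec_left, ← hUx, hUinner, ContinuousLinearEquiv.apply_symm_apply,
      inner_kerVec_left]

end Comparison

/-! ### Compact self-adjoint operators on invariant subspaces -/

section SpectralTheorem

variable {H : Type*} [NormedAddCommGroup H] [InnerProductSpace ℝ H] [CompleteSpace H]
  {L : Type*} [NormedAddCommGroup L] [InnerProductSpace ℝ L] [CompleteSpace L]

/-- A compact self-adjoint operator vanishes on each closed invariant subspace that contains no
eigenvector for a nonzero eigenvalue. -/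
theorem ContinuousLinearMap.apply_eq_zero_of_no_eigenvector_mem {T : H →L[ℝ] H}
    (hTc : IsCompactOperator T) (hT : (T : H →ₗ[ℝ] H).IsSymmetric) {W : Submodule ℝ H}
    (hWc : IsClosed (W : Set H)) (hW : ∀ w ∈ W, T w ∈ W)
    (hev : ∀ (c : ℝ), ∀ w, c ≠ 0 → w ∈ W → T w = c • w → w = 0) (w : H) (hw : w ∈ W) :
    T w = 0 := by
  have : CompleteSpace W := hWc.completeSpace_coe
  have hSc : IsCompactOperator (T.restrict hW) := hTc.restrict' hW
  have hS : ((T.restrict hW : W →L[ℝ] W) : W →ₗ[ℝ] W).IsSymmetric := hT.restrict_invariant hW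
  have hS0 : T.restrict hW = 0 := by
    rw [← ContinuousLinearMap.eq_zero_of_forall_hasEigenvalue_eq_zero hSc hS]
    intro c hc
    by_contra hc0
    obtain ⟨⟨w, hw⟩, hwc, hw0⟩ := hc.exists_hasEigenvector
    rw [Module.End.mem_eigenspace_iff] at hwc
    exact hw0 (Subtype.ext (hev c w hc0 hw (congrArg Subtype.val hwc)))
  exact congrArg Subtype.val (DFunLike.congr_fun hS0 ⟨w, hw⟩)

/-- A closed subspace that is invariant under `J† J`, for `J` compact and injective, is trivial if
it has no eigenvector. -/
theorem forall_mem_eq_zero_of_adjoint_comp_self (J : H →L[ℝ] L) (hJc : IsCompactOperator J)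
    (hJi : Function.Injective J) {W : Submodule ℝ H} (hWc : IsClosed (W : Set H))
    (hW : ∀ w ∈ W, J.adjoint (J w) ∈ W)
    (hev : ∀ (c : ℝ), ∀ w, c ≠ 0 → w ∈ W → J.adjoint (J w) = c • w → w = 0) :
    ∀ w ∈ W, w = 0 := by
  intro w hw
  have hTw : J.adjoint (J w) = 0 :=
    ContinuousLinearMap.apply_eq_zero_of_no_eigenvector_mem (T := J.adjoint.comp J)
      (hJc.clm_comp J.adjoint) (fun v w => (J.adjoint_inner_left w (J v)).trans
        (J.adjoint_inner_right v (J w)).symm) hWc hW hev w hw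
  refine hJi ?_
  rw [map_zero, ← inner_self_eq_zero (𝕜 := ℝ), ← ContinuousLinearMap.adjoint_inner_left, hTw,
    inner_zero_left]

end SpectralTheorem

/-! ### Mercer basis and expansion of the transformed kernel -/

section Mercer

variable {X : Type*} [MeasurableSpace X] {μ : Measure X} {k : X → X → ℝ} {ι : Type*} {η : ι → ℝ}
  {φ : ι → X → ℝ} {H : Type*} [NormedAddCommGroup H] [InnerProductSpace ℝ H] [CompleteSpace H]
  [RKHS ℝ H X ℝ]

theorem inner_Lp_eq_integral {f g : Lp ℝ 2 μ} {f' g' : X → ℝ} (hf : f =ᵐ[μ] f') (hg : g =ᵐ[μ] g') :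
    ⟪f, g⟫_ℝ = ∫ x, f' x * g' x ∂μ := by
  rw [L2.inner_def]
  refine integral_congr_ae ?_
  filter_upwards [hf, hg] with x hfx hgx
  rw [hfx, hgx, real_inner_eq_re_inner]
  simp [mul_comm]

theorem IsRKHSOf.adjoint_apply (hH : IsRKHSOf k H) {J : H →L[ℝ] Lp ℝ 2 μ}
    (hJ : ∀ h, J h =ᵐ[μ] h) {f : Lp ℝ 2 μ} {f' : X → ℝ} (hf : f =ᵐ[μ] f') (x : X)
    (hsymm : ∀ x y, k x y = k y x) :
    J.adjoint f x = ∫ y, k x y * f' y ∂μ := by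
  rw [← inner_kerVec_left, ContinuousLinearMap.adjoint_inner_right,
    inner_Lp_eq_integral (hJ _) hf]
  simp_rw [hH.kerVec_apply, hsymm _ x]

/-- The image of the `i`-th eigenfunction under the adjoint of the inclusion `H → L²`. As a
function it is `η i * φ i`. -/
noncomputable def IsMercerSystem.adjointEigenfunction (hηφ : IsMercerSystem μ k η φ)
    (J : H →L[ℝ] Lp ℝ 2 μ) (i : ι) : H :=
  J.adjoint ((hηφ.memLp i).toLp (φ i))

namespace IsMercerSystem

variable {J : H →L[ℝ] Lp ℝ 2 μ}

theorem adjointEigenfunction_apply (hηφ : IsMercerSystem μ k η φ)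
    (hH : IsRKHSOf k H) (hsymm : ∀ x y, k x y = k y x)
    (hJ : ∀ h, J h =ᵐ[μ] h) (i : ι) (x : X) :
    hηφ.adjointEigenfunction J i x = η i * φ i x := by
  rw [adjointEigenfunction, hH.adjoint_apply hJ (MemLp.coeFn_toLp _) x hsymm, hηφ.eigen]

theorem map_adjointEigenfunction (hηφ : IsMercerSystem μ k η φ)
    (hH : IsRKHSOf k H) (hsymm : ∀ x y, k x y = k y x)
    (hJ : ∀ h, J h =ᵐ[μ] h) (i : ι) :
    J (hηφ.adjointEigenfunction J i) = η i • (hηφ.memLp i).toLp (φ i) := by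
  apply Lp.ext
  filter_upwards [hJ (hηφ.adjointEigenfunction J i),
    Lp.coeFn_smul (η i) ((hηφ.memLp i).toLp (φ i)), (hηφ.memLp i).coeFn_toLp] with x h₁ h₂ h₃
  rw [h₁, h₂, Pi.smul_apply, h₃, hηφ.adjointEigenfunction_apply hH hsymm hJ, smul_eq_mul]

theorem adjoint_map_adjointEigenfunction (hηφ : IsMercerSystem μ k η φ)
    (hH : IsRKHSOf k H) (hsymm : ∀ x y, k x y = k y x)
    (hJ : ∀ h, J h =ᵐ[μ] h) (i : ι) :
    J.adjoint (J (hηφ.adjointEigenfunction J i)) = η i • hηφ.adjointEigenfunction J i := by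
  rw [hηφ.map_adjointEigenfunction hH hsymm hJ, map_smul, adjointEigenfunction]

theorem inner_adjointEigenfunction (hηφ : IsMercerSystem μ k η φ)
    (hH : IsRKHSOf k H) (hsymm : ∀ x y, k x y = k y x)
    (hJ : ∀ h, J h =ᵐ[μ] h) (i j : ι) :
    ⟪hηφ.adjointEigenfunction J i, hηφ.adjointEigenfunction J j⟫_ℝ =
      η i * ∫ x, φ i x * φ j x ∂μ := by
  nth_rw 2 [adjointEigenfunction]
  rw [ContinuousLinearMap.adjoint_inner_right, hηφ.map_adjointEigenfunction hH hsymm hJ,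
    real_inner_smul_left,
    inner_Lp_eq_integral (hηφ.memLp i).coeFn_toLp (hηφ.memLp j).coeFn_toLp]

theorem norm_adjointEigenfunction_sq (hηφ : IsMercerSystem μ k η φ)
    (hH : IsRKHSOf k H) (hsymm : ∀ x y, k x y = k y x)
    (hJ : ∀ h, J h =ᵐ[μ] h) (i : ι) : ‖hηφ.adjointEigenfunction J i‖ ^ 2 = η i := by
  have := hηφ.norm_one i
  simp_rw [sq] at this
  rw [← real_inner_self_eq_norm_sq, hηφ.inner_adjointEigenfunction hH hsymm hJ, this, mul_one]

theorem eigenvalue_nonneg (hηφ : IsMercerSystem μ k η φ)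
    (hH : IsRKHSOf k H) (hsymm : ∀ x y, k x y = k y x)
    (hJ : ∀ h, J h =ᵐ[μ] h) (i : ι) : 0 ≤ η i :=
  hηφ.norm_adjointEigenfunction_sq hH hsymm hJ i ▸ sq_nonneg _

/-- The complement is invariant under `J†J`. An eigenvector in it for a nonzero eigenvalue would be
an eigenfunction of the integral operator orthogonal to all `φ i`, which exhaustiveness excludes. -/
theorem orthogonal_span_adjointEigenfunction (hηφ : IsMercerSystem μ k η φ)
    (hH : IsRKHSOf k H)
    (hsymm : ∀ x y, k x y = k y x) (hJ : ∀ h, J h =ᵐ[μ] h) (hJc : IsCompactOperator J)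
    (hJi : Function.Injective J) :
    (Submodule.span ℝ (Set.range (hηφ.adjointEigenfunction J)))ᗮ = ⊥ := by
  have hWmem : ∀ w, w ∈ (Submodule.span ℝ (Set.range (hηφ.adjointEigenfunction J)))ᗮ ↔
      ∀ i, ⟪hηφ.adjointEigenfunction J i, w⟫_ℝ = 0 := by
    intro w
    rw [Submodule.mem_orthogonal]
    refine ⟨fun h i => h _ (Submodule.subset_span ⟨i, rfl⟩), fun h u hu => ?_⟩
    induction hu using Submodule.span_induction with
    | mem u hu => obtain ⟨i, rfl⟩ := hu; exact h i
    | zero => exact inner_zero_left _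
    | add u v _ _ hu hv => rw [inner_add_left, hu, hv, add_zero]
    | smul c u _ hu => rw [real_inner_smul_left, hu, mul_zero]
  rw [Submodule.eq_bot_iff]
  refine forall_mem_eq_zero_of_adjoint_comp_self J hJc hJi
    (Submodule.isClosed_orthogonal _) (fun w hw => ?_) fun c w hc0 hw hTw => ?_
  · rw [hWmem] at hw ⊢
    intro i
    rw [ContinuousLinearMap.adjoint_inner_right, ← ContinuousLinearMap.adjoint_inner_left,
      hηφ.adjoint_map_adjointEigenfunction hH hsymm hJ, real_inner_smul_left, hw, mul_zero]
  · refine hJi ?_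
    rw [map_zero]
    apply Lp.ext
    refine (hJ w).trans (Filter.EventuallyEq.trans ?_ (Lp.coeFn_zero ℝ 2 μ).symm)
    refine hηφ.exhaustive c w hc0 ((memLp_congr_ae (hJ w)).1 (Lp.memLp _)) (fun x => ?_) fun i => ?_
    · rw [← hH.adjoint_apply hJ (hJ w) x hsymm, hTw, RKHS.coe_smul, Pi.smul_apply, smul_eq_mul]
    · rw [← inner_Lp_eq_integral (hJ w) (hηφ.memLp i).coeFn_toLp,
        ← ContinuousLinearMap.adjoint_inner_right, real_inner_comm]
      exact (hWmem w).1 hw i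

/-- Mercer's theorem in the form of a Hilbert basis: the functions `√η i * φ i` with `η i ≠ 0` form
a Hilbert basis of the reproducing kernel Hilbert space. -/
theorem exists_hilbertBasis (hηφ : IsMercerSystem μ k η φ)
    (hH : IsRKHSOf k H)
    (hsymm : ∀ x y, k x y = k y x) (hJ : ∀ h, J h =ᵐ[μ] h) (hJc : IsCompactOperator J)
    (hJi : Function.Injective J) :
    ∃ b : HilbertBasis {i // η i ≠ 0} ℝ H, (∀ i x, b i x = √(η i) * φ i x) ∧
      ∀ i, J.adjoint (J (b i)) = η i • b i := by
  have hη := hηφ.eigenvalue_nonneg hH hsymm hJ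
  -- The vector `J† φ i` has squared norm `η i`, so this normalizes it; indices with `η i = 0` give
  -- the zero vector.
  let v : {i // η i ≠ 0} → H := fun i => (√(η i))⁻¹ • hηφ.adjointEigenfunction J i
  have hv : Orthonormal ℝ v := by
    constructor
    · intro i
      have h := hηφ.norm_adjointEigenfunction_sq hH hsymm hJ i
      rw [norm_smul, norm_inv, Real.norm_of_nonneg (Real.sqrt_nonneg _), ← h,
        Real.sqrt_sq (norm_nonneg _)]
      refine inv_mul_cancel₀ fun h0 => i.2 ?_
      rw [← h, h0, sq, zero_mul]
    · intro i j hij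
      change ⟪v i, v j⟫_ℝ = 0
      rw [real_inner_smul_left, real_inner_smul_right,
        hηφ.inner_adjointEigenfunction hH hsymm hJ,
        hηφ.orthogonal _ _ fun h => hij (Subtype.ext h)]
      simp
  have hspan : (Submodule.span ℝ (Set.range v))ᗮ = ⊥ := by
    rw [eq_bot_iff, ← hηφ.orthogonal_span_adjointEigenfunction hH hsymm hJ hJc hJi]
    refine Submodule.orthogonal_le (Submodule.span_le.2 ?_)
    rintro _ ⟨i, rfl⟩
    by_cases hi : η i = 0
    · have h := hηφ.norm_adjointEigenfunction_sq hH hsymm hJ i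
      rw [hi, sq_eq_zero_iff, norm_eq_zero] at h
      rw [h]
      exact zero_mem _
    · have hs : √(η i) ≠ 0 := (Real.sqrt_ne_zero (hη i)).2 hi
      have : hηφ.adjointEigenfunction J i = √(η i) • v ⟨i, hi⟩ := by
        simp [v, smul_smul, hs]
      rw [this]
      exact Submodule.smul_mem _ _ (Submodule.subset_span ⟨_, rfl⟩)
  refine ⟨HilbertBasis.mkOfOrthogonalEqBot hv hspan, fun i x => ?_, fun i => ?_⟩
  · rw [HilbertBasis.coe_mkOfOrthogonalEqBot, RKHS.coe_smul, Pi.smul_apply, smul_eq_mul,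
      hηφ.adjointEigenfunction_apply hH hsymm hJ, ← mul_assoc, inv_mul_eq_div, Real.div_sqrt]
  · rw [HilbertBasis.coe_mkOfOrthogonalEqBot]
    simp only [v, map_smul, hηφ.adjoint_map_adjointEigenfunction hH hsymm hJ]
    rw [smul_comm]

/-- Parseval's identity for `k_x` and `B⁻¹ k_y`: the basis diagonalizes `B` with eigenvalues `η i +
γ`, and the indices with `η i = 0` contribute nothing. -/
theorem hasSum_transformedKernel (hηφ : IsMercerSystem μ k η φ)
    (hH : IsRKHSOf k H)
    (hsymm : ∀ x y, k x y = k y x) (hJ : ∀ h, J h =ᵐ[μ] h) (hJc : IsCompactOperator J)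
    (hJi : Function.Injective J) {γ : ℝ} (hγ : 0 < γ) {B : H ≃L[ℝ] H}
    (hB : ∀ v w, ⟪B v, w⟫_ℝ = ⟪J v, J w⟫_ℝ + γ * ⟪v, w⟫_ℝ) (x y : X) :
    HasSum (fun i => η i / (η i + γ) * φ i x * φ i y)
      ⟪kerVec H x, B.symm (kerVec H y)⟫_ℝ := by
  obtain ⟨b, hb, hTb⟩ := hηφ.exists_hilbertBasis hH hsymm hJ hJc hJi
  have hη := hηφ.eigenvalue_nonneg hH hsymm hJ
  have hby : ∀ i : {i // η i ≠ 0}, (η i + γ) * ⟪b i, B.symm (kerVec H y)⟫_ℝ = b i y := by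
    intro i
    rw [← inner_kerVec_left, ← B.apply_symm_apply (kerVec H y), hB, B.symm_apply_apply,
      ← ContinuousLinearMap.adjoint_inner_right J, hTb, real_inner_smul_right, ← add_mul,
      real_inner_comm (b i)]
  have hsub := b.hasSum_inner_mul_inner (kerVec H x) (B.symm (kerVec H y))
  have hsupp : Function.support (fun i => η i / (η i + γ) * φ i x * φ i y) ⊆ {i | η i ≠ 0} := by
    intro i hi h0
    exact hi (by simp [h0])
  rw [← hasSum_subtype_iff_of_support_subset hsupp]
  refine HasSum.congr_fun hsub fun i => ?_
  have hpos : η i + γ ≠ 0 := (add_pos_of_nonneg_of_pos (hη i) hγ).ne'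
  rw [inner_kerVec_left, eq_div_of_mul_eq hpos ((mul_comm _ _).trans (hby i)), hb, hb]
  simp only [Function.comp_apply]
  nth_rw 1 [← Real.mul_self_sqrt (hη i)]
  ring

end IsMercerSystem

end Mercer

/-! ### Positive semidefinite kernels -/

section Existence

variable {X : Type*} {k : X → X → ℝ}

open scoped ComplexOrder in
theorem IsPosSemidefKernel.posSemidef_scalarKernel (hk : IsPosSemidefKernel k) :
    (scalarKernel k).PosSemidef := by
  have htfae := (RKHS.posSemidef_tfae (K := scalarKernel k)).out 0 2
  refine htfae.2 ⟨?_, fun c => ?_⟩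
  · ext x y
    simp [scalarKernel, hk.1 x y, ← ContinuousLinearMap.one_def]
  · have h := hk.2 c.support.card (fun i => (c.support.equivFin.symm i : X))
      fun i => c (c.support.equivFin.symm i)
    simp only [Finsupp.sum, scalarKernel, Matrix.of_apply, map_sum]
    rw [← Finset.sum_coe_sort c.support]
    simp_rw [← Finset.sum_coe_sort c.support]
    rw [← c.support.equivFin.symm.sum_comp]
    simp_rw [← c.support.equivFin.symm.sum_comp]
    rw [Finset.sum_comm] at h
    convert h using 4 with i _ j _
    simp
    ring

theorem isPosSemidefKernel_of_inner {F : Type*} [NormedAddCommGroup F] [InnerProductSpace ℝ F]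
    (T : F →ₗ[ℝ] F) (hsymm : T.IsSymmetric) (hpos : ∀ v, 0 ≤ ⟪T v, v⟫_ℝ) (g : X → F)
    (hk : ∀ x y, k x y = ⟪T (g x), g y⟫_ℝ) : IsPosSemidefKernel k := by
  refine ⟨fun x y => ?_, fun m x c => ?_⟩
  · rw [hk, hk, hsymm, real_inner_comm]
  · have h := hpos (∑ i, c i • g (x i))
    simp only [map_sum, map_smul, sum_inner, inner_sum, real_inner_smul_left,
      real_inner_smul_right, ← hk] at h
    rw [Finset.sum_comm]
    simpa only [mul_assoc, mul_left_comm] using h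

end Existence

/-! ### Assembly -/

section Main

variable {X : Type*} [TopologicalSpace X] [CompactSpace X] [MeasurableSpace X] [BorelSpace X]
  {μ : Measure X} [IsFiniteMeasure μ] [μ.IsOpenPosMeasure] {k : X → X → ℝ} {ι : Type*}
  {η : ι → ℝ} {φ : ι → X → ℝ} {γ : ℝ}

/-- The feature map `B⁻¹ k_y` of the transformed kernel, together with the inner product
`⟪B f, g⟫ = ∫ f g + γ ⟪f, g⟫` on the reproducing kernel Hilbert space of `k`. -/
theorem IsMercerSystem.exists_equiv_hasSum (hηφ : IsMercerSystem μ k η φ)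
    (hk_cont : Continuous fun p : X × X => k p.1 p.2) (hsymm : ∀ x y, k x y = k y x) (hγ : 0 < γ)
    {H : Type*} [NormedAddCommGroup H] [InnerProductSpace ℝ H] [CompleteSpace H] [RKHS ℝ H X ℝ]
    (hH : IsRKHSOf k H) :
    ∃ B : H ≃L[ℝ] H, (∀ v w, ⟪B v, w⟫_ℝ = ∫ x, v x * w x ∂μ + γ * ⟪v, w⟫_ℝ) ∧
      (∀ h : H, Integrable (fun x => h x ^ 2) μ) ∧
      ∀ x y, HasSum (fun i => η i / (η i + γ) * φ i x * φ i y)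
        ⟪kerVec H x, B.symm (kerVec H y)⟫_ℝ := by
  obtain ⟨J, hJ, hJc, hJi⟩ :=
    RKHS.exists_isCompactOperator_Lp μ (hH.continuous_kerVec hk_cont)
  obtain ⟨B, hB⟩ := exists_equiv_adjoint_comp_self_add_smul J hγ
  refine ⟨B, fun v w => ?_, fun h => ?_, fun x y => ?_⟩
  · rw [hB, inner_Lp_eq_integral (hJ v) (hJ w)]
  · exact ((memLp_congr_ae (hJ h)).1 (Lp.memLp (J h))).integrable_sq
  · exact hηφ.hasSum_transformedKernel hH hsymm hJ hJc hJi hγ hB x y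

theorem IsMercerSystem.summable_and_isPosSemidefKernel (hηφ : IsMercerSystem μ k η φ)
    (hk_cont : Continuous fun p : X × X => k p.1 p.2) (hk : IsPosSemidefKernel k) (hγ : 0 < γ) :
    (∀ x y, Summable fun i => η i / (η i + γ) * φ i x * φ i y) ∧
      IsPosSemidefKernel (transformedKernel γ η φ) := by
  -- The conclusion mentions no Hilbert space, so an RKHS of `k` is constructed here.
  have : Fact (scalarKernel k).PosSemidef := ⟨hk.posSemidef_scalarKernel⟩
  have hH : IsRKHSOf k (RKHS.OfKernel (scalarKernel k)) := RKHS.OfKernel.kernel_ofKernel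
  obtain ⟨B, hB, -, hsum⟩ := hηφ.exists_equiv_hasSum hk_cont hk.1 hγ hH
  refine ⟨fun x y => (hsum x y).summable, ?_⟩
  refine isPosSemidefKernel_of_inner (B : _ →L[ℝ] _).toLinearMap (fun v w => ?_) (fun v => ?_)
    (fun x => B.symm (kerVec _ x)) fun x y => ?_
  · change ⟪B v, w⟫_ℝ = ⟪v, B w⟫_ℝ
    rw [← real_inner_comm v, hB, hB, real_inner_comm w v]
    simp_rw [mul_comm (v _)]
  · change 0 ≤ ⟪B v, v⟫_ℝ
    rw [hB]
    exact add_nonneg (integral_nonneg fun x => mul_self_nonneg _)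
      (mul_nonneg hγ.le real_inner_self_nonneg)
  · change _ = ⟪B (B.symm _), _⟫_ℝ
    rw [B.apply_symm_apply]
    exact (hsum x y).tsum_eq

theorem IsMercerSystem.exists_surjective_transformed (hηφ : IsMercerSystem μ k η φ)
    (hk_cont : Continuous fun p : X × X => k p.1 p.2) (hsymm : ∀ x y, k x y = k y x) (hγ : 0 < γ)
    {H : Type*} [NormedAddCommGroup H] [InnerProductSpace ℝ H] [CompleteSpace H] [RKHS ℝ H X ℝ]
    {H' : Type*} [NormedAddCommGroup H'] [InnerProductSpace ℝ H'] [CompleteSpace H']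
    [RKHS ℝ H' X ℝ] (hH : IsRKHSOf k H) (hH' : IsRKHSOf (transformedKernel γ η φ) H') :
    ∃ U : H → H', Function.Surjective U ∧ (∀ h, (U h : X → ℝ) = h) ∧
      ∀ h, Integrable (fun x => h x ^ 2) μ ∧ ∫ x, h x ^ 2 ∂μ + γ * ‖h‖ ^ 2 = ‖U h‖ ^ 2 := by
  obtain ⟨B, hB, hint, hsum⟩ := hηφ.exists_equiv_hasSum hk_cont hsymm hγ hH
  have hBh : ∀ h, ⟪B h, h⟫_ℝ = ∫ x, h x ^ 2 ∂μ + γ * ‖h‖ ^ 2 := fun h => by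
    rw [hB, real_inner_self_eq_norm_sq]
    simp_rw [sq]
  have hBγ : ∀ h, γ * ‖h‖ ^ 2 ≤ ⟪B h, h⟫_ℝ := fun h => by
    rw [hBh]
    exact le_add_of_nonneg_left (integral_nonneg fun x => sq_nonneg _)
  obtain ⟨U, hU, hUx, hUn⟩ := RKHS.exists_equiv_of_kernel_eq_inner_symm (H' := H') B hγ hBγ
    fun x y => (inner_kerVec_left _ _).trans ((hH'.kerVec_apply x y).trans (hsum x y).tsum_eq)
  exact ⟨U, hU, fun h => funext (hUx h), fun h => ⟨hint h, by rw [hUn, hBh]⟩⟩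

end Main

theorem isFiniteMeasure_lebesgueOn {d : ℕ} {S : Set (EuclideanSpace ℝ (Fin d))}
    (hS : IsCompact S) : IsFiniteMeasure (lebesgueOn S) := by
  refine ⟨?_⟩
  rw [lebesgueOn, (MeasurableEmbedding.subtype_coe hS.measurableSet).comap_apply, Set.image_univ,
    Subtype.range_coe]
  exact hS.measure_lt_top

theorem lemma2 {d : ℕ} (S : Set (EuclideanSpace ℝ (Fin d))) (hS : IsCompact S)
    (hpos : (lebesgueOn S).IsOpenPosMeasure)
    (k : S → S → ℝ) (hk_cont : Continuous fun p : S × S => k p.1 p.2)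
    (hk : IsPosSemidefKernel k)
    {ι : Type*} (η : ι → ℝ) (φ : ι → S → ℝ) (hηφ : IsMercerSystem (lebesgueOn S) k η φ)
    (γ : ℝ) (hγ : 0 < γ) :
    (∀ x y : S, Summable fun i => η i / (η i + γ) * φ i x * φ i y) ∧
    IsPosSemidefKernel (transformedKernel γ η φ) ∧
    ∀ (H : Type*) [NormedAddCommGroup H] [InnerProductSpace ℝ H] [CompleteSpace H]
      [RKHS ℝ H S ℝ] (H' : Type*) [NormedAddCommGroup H'] [InnerProductSpace ℝ H']
      [CompleteSpace H'] [RKHS ℝ H' S ℝ],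
      IsRKHSOf k H → IsRKHSOf (transformedKernel γ η φ) H' →
      (Set.range fun h : H => (h : S → ℝ)) = (Set.range fun h' : H' => (h' : S → ℝ)) ∧
      ∀ (h : H) (h' : H'), (h : S → ℝ) = (h' : S → ℝ) →
        Integrable (fun x : S => h x ^ 2) (lebesgueOn S) ∧
        (∫ x : S, h x ^ 2 ∂(lebesgueOn S)) + γ * ‖h‖ ^ 2 = ‖h'‖ ^ 2 ∧
        ∀ (n : ℕ) (t : Fin n → S),
          penalizedObjective (lebesgueOn S) t γ h = mergedObjective t h' := by
  have : CompactSpace S := isCompact_iff_compactSpace.1 hS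
  have : IsFiniteMeasure (lebesgueOn S) := isFiniteMeasure_lebesgueOn hS
  obtain ⟨hsum, hpsd⟩ := hηφ.summable_and_isPosSemidefKernel hk_cont hk hγ
  refine ⟨hsum, hpsd, ?_⟩
  intro H _ _ _ _ H' _ _ _ _ hH hH'
  obtain ⟨U, hU, hUcoe, hUn⟩ := hηφ.exists_surjective_transformed hk_cont hk.1 hγ hH hH'
  refine ⟨?_, fun h h' hh' => ?_⟩
  · ext f
    constructor
    · rintro ⟨h, rfl⟩
      exact ⟨U h, hUcoe h⟩
    · rintro ⟨h', rfl⟩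
      obtain ⟨h, rfl⟩ := hU h'
      exact ⟨h, (hUcoe h).symm⟩
  -- An element of an RKHS is determined by its function, so `h'` can only be `U h`.
  · obtain rfl : U h = h' := DFunLike.coe_injective ((hUcoe h).trans hh')
    refine ⟨(hUn h).1, (hUn h).2, fun n t => ?_⟩
    have hdata : dataTerm t (U h) = dataTerm t h := by rw [hUcoe]
    rw [penalizedObjective, mergedObjective, add_assoc, ← EReal.coe_add, (hUn h).2, hdata]
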